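/- Let $R=(r_1,\dots,r_m)$ and $S=(s_1,\dots,s_n)$ be monotone nonincreasing vectors of nonnegative integers, and let $\mathcal A(R,S)$ be the class of all $m\times n$ $(0,1)$-matrices with row sum vector $R$ and column sum vector $S$. For a $(0,1)$-matrix $A$ and an integer $k\ge 0$, let $\rho_k(A)$ (the $k$-term rank) be the maximum number of $1$s of $A$ with at most one $1$ chosen in each column and at most $k$ $1$s chosen in each row; in particular $\rho_0(A)=0$. If $\mathcal A(R,S)\neq\emptyset$, put $\overline{\rho_k}=\max\{\rho_k(A):A\in\mathcal A(R,S)\}$. Suppose that $\mathcal A(R,S)$ is nonempty, and let $t$ be a positive integer with $\overline{\rho_t}\le n$. Define \[ p_t=\overline{\rho_t}-\overline{\rho_{t-1}},\qquad p_k=2\overline{\rho_k}-\overline{\rho_{k+1}}-\overline{\rho_{k-1}}\quad(1\le k<t). \] Then $p_1,\dots,p_t$ are nonnegative, and there exist a matrix $A\in\mathcal A(R,S)$ and a $(0,1)$-matrix $B\le A$ (entrywise) such that (i) $\rho_k(A)=\overline{\rho_k}$ for all $k=1,2,\dots,t$; (ii) $B$ contains exactly $\overline{\rho_t}$ $1$s,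 where (a) these $1$s lie within the leading $\overline{\rho_1}\times\overline{\rho_t}$ submatrix of $B$; (b) each of the first $\overline{\rho_t}$ columns of $B$ contains exactly one $1$; (c) each of the first $\overline{\rho_1}$ rows of $B$ contains at most $t$ $1$s, with the first $p_t$ rows each containing $t$ $1$s, the next $p_{t-1}$ rows each containing $t-1$ $1$s, $\dots$, and the next $p_1$ rows each containing one $1$. -/

import Mathlib

namespace TermRank

/-- Every entry of the matrix is `0` or `1`. -/
def IsZeroOne {m n : ℕ} (A : Matrix (Fin m) (Fin n) ℕ) : Prop :=
  ∀ i j, A i j = 0 ∨ A i j = 1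

/-- The `i`-th row sum. -/
def rowSum {m n : ℕ} (A : Matrix (Fin m) (Fin n) ℕ) (i : Fin m) : ℕ :=
  ∑ j, A i j

/-- The `j`-th column sum. -/
def colSum {m n : ℕ} (A : Matrix (Fin m) (Fin n) ℕ) (j : Fin n) : ℕ :=
  ∑ i, A i j

/-- The sum of all entries. -/
def entrySum {m n : ℕ} (A : Matrix (Fin m) (Fin n) ℕ) : ℕ :=
  ∑ i, ∑ j, A i j

/-- The class of all `(0,1)`-matrices with row sum vector `R` and column sum vector `S`. -/
def matrixClass {m n : ℕ} (R : Fin m → ℕ) (S : Fin n → ℕ) :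
    Set (Matrix (Fin m) (Fin n) ℕ) :=
  {A | IsZeroOne A ∧ (∀ i, rowSum A i = R i) ∧ (∀ j, colSum A j = S j)}

/-- `B` selects `1`s of `A`, at most `t` in each row and at most one in each column. -/
def IsSelection {m n : ℕ} (t : ℕ) (A B : Matrix (Fin m) (Fin n) ℕ) : Prop :=
  IsZeroOne B ∧ (∀ i j, B i j ≤ A i j) ∧ (∀ i, rowSum B i ≤ t) ∧ (∀ j, colSum B j ≤ 1)

/-- The `t`-term rank: the maximum number of `1`s of `A` with at most `t` in each row and at most
one in each column. -/
noncomputable def termRank {m n : ℕ} (t : ℕ) (A : Matrix (Fin m) (Fin n) ℕ) : ℕ :=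
  sSup {p | ∃ B, IsSelection t A B ∧ entrySum B = p}

/-- The maximum `t`-term rank over the class of `R` and `S`. -/
noncomputable def maxTermRank {m n : ℕ} (t : ℕ) (R : Fin m → ℕ) (S : Fin n → ℕ) : ℕ :=
  sSup {p | ∃ A ∈ matrixClass R S, termRank t A = p}

/-- The integers `p_k` for `1 ≤ k ≤ t` (computed in `ℤ`): the last first difference for `k = t`,
and minus the second difference for `1 ≤ k < t`, of the sequence of maximum `k`-term ranks. -/
noncomputable def stairMult {m n : ℕ} (t : ℕ) (R : Fin m → ℕ) (S : Fin n → ℕ) (k : ℕ) : ℤ :=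
  if k = t then (maxTermRank t R S : ℤ) - maxTermRank (t - 1) R S
  else 2 * (maxTermRank k R S : ℤ) - maxTermRank (k + 1) R S - maxTermRank (k - 1) R S

theorem IsSelection.entrySum_le {m n t : ℕ} {A B : Matrix (Fin m) (Fin n) ℕ}
    (h : IsSelection t A B) : entrySum B ≤ n := by
  calc entrySum B = ∑ j, ∑ i, B i j := Finset.sum_comm
    _ ≤ ∑ _j : Fin n, 1 := Finset.sum_le_sum fun j _ => h.2.2.2 j
    _ = n := by simp

/-- The `t`-term rank is a maximum that is attained. -/
theorem termRank_isGreatest {m n : ℕ} (t : ℕ) (A : Matrix (Fin m) (Fin n) ℕ) :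
    IsGreatest {p | ∃ B, IsSelection t A B ∧ entrySum B = p} (termRank t A) := by
  have hb : BddAbove {p | ∃ B, IsSelection t A B ∧ entrySum B = p} := by
    refine ⟨n, ?_⟩
    rintro p ⟨B, hB, rfl⟩
    exact hB.entrySum_le
  refine ⟨Nat.sSup_mem ⟨0, 0, ?_, ?_⟩ hb, fun p hp => le_csSup hb hp⟩
  · refine ⟨fun _ _ => Or.inl rfl, fun _ _ => Nat.zero_le _, fun _ => ?_, fun _ => ?_⟩ <;>
      simp [rowSum, colSum]
  · simp [entrySum]

theorem termRank_le {m n : ℕ} (t : ℕ) (A : Matrix (Fin m) (Fin n) ℕ) : termRank t A ≤ n := by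
  obtain ⟨B, hB, h⟩ := (termRank_isGreatest t A).1
  rw [← h]
  exact hB.entrySum_le

/-- Over a nonempty class the maximum `t`-term rank is a maximum that is attained. -/
theorem maxTermRank_isGreatest {m n : ℕ} (t : ℕ) (R : Fin m → ℕ) (S : Fin n → ℕ)
    (hne : (matrixClass R S).Nonempty) :
    IsGreatest {p | ∃ A ∈ matrixClass R S, termRank t A = p} (maxTermRank t R S) := by
  have hb : BddAbove {p | ∃ A ∈ matrixClass R S, termRank t A = p} := by
    refine ⟨n, ?_⟩
    rintro p ⟨A, _, rfl⟩
    exact termRank_le t A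
  obtain ⟨A, hA⟩ := hne
  exact ⟨Nat.sSup_mem ⟨_, A, hA, rfl⟩ hb, fun p hp => le_csSup hb hp⟩

end TermRank

/-!
Let `P` be the set of row sum vectors of matrices `B ≤ A` with column sums at most `1`, where `A`
runs through the class. The maximum `k`-term rank of the class is the largest sum of an `x ∈ P` with
all entries at most `k`. The point is that `P` is an integral polymatroid.

To see this, `P` is described without reference to `A`: if the class is nonempty, then `x ∈ P` as
soon as there is a `(0,1)`-matrix `C` with row sum vector `R - x` whose column sums equal those of
`S` or are one less (`IsRowVector`). For such a `C` can be rearranged, keeping its row and column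
sums, so as to lie below a member `A` of the class (`exists_le_of_colSum_le`), and then `B = A - C`.
As `S` is nonincreasing, the deficient columns of `C` can also be taken to be the first ones
(`exists_colSum_add_eq`). In this description the augmentation property of `P`
(`IsRowVector.exists_augment`) follows by flipping alternating walks in the symmetric difference of
two `(0,1)`-matrices.

In a polymatroid the vectors of largest sum for the bounds `k = 0, 1, 2, …` can be built one on top
of the other, so one `x ∈ P` bounded by `t` satisfies `∑ i, min (x i) k = maxTermRank k R S` for
all `k ≤ t` at once. As `R` is nonincreasing, unit transfers make `x` nonincreasing
(`exists_antitone_isRowVector`). Taking differences in `k`, exactly `p_k` entries of `x` equal `k`,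
so that `p_k` is nonnegative, and the matrices `A` and `B` that realize `x` are the required ones.
-/

namespace TermRank

open Finset

/-! ### Row and column sums under small changes -/

section Sums

variable {m n : ℕ}

theorem exists_forall_le_of_exists {α : Type*} (f : α → ℕ) {p : α → Prop} (h : ∃ a, p a) :
    ∃ a, p a ∧ ∀ b, p b → f a ≤ f b := by
  obtain ⟨a, ha, hmin⟩ := WellFounded.has_min (measure f).wf {a | p a} h
  exact ⟨a, ha, fun b hb => not_lt.1 (hmin b hb)⟩

/-- A downward closed set of `c` elements of `Fin n` consists of the first `c` elements. -/
theorem iff_lt_card_filter (p : Fin n → Prop) [DecidablePred p]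
    (h : ∀ i j, i ≤ j → p j → p i) (i : Fin n) :
    p i ↔ (i : ℕ) < #{j | p j} := by
  constructor
  · intro hi
    have hsub : Iic i ⊆ ({j | p j} : Finset (Fin n)) := fun j hj => by
      simpa using h j i (by simpa using hj) hi
    have := card_le_card hsub
    rw [Fin.card_Iic] at this
    omega
  · intro hi
    by_contra hpi
    have hsub : ({j | p j} : Finset (Fin n)) ⊆ Iio i := fun j hj => by
      rw [mem_Iio]
      by_contra hij
      exact hpi (h i j (not_lt.1 hij) (by simpa using hj))
    have := card_le_card hsub
    rw [Fin.card_Iio] at this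
    omega

theorem rowSum_add (A B : Matrix (Fin m) (Fin n) ℕ) (i : Fin m) :
    rowSum (A + B) i = rowSum A i + rowSum B i := by
  simp [rowSum, sum_add_distrib]

theorem colSum_add (A B : Matrix (Fin m) (Fin n) ℕ) (j : Fin n) :
    colSum (A + B) j = colSum A j + colSum B j := by
  simp [colSum, sum_add_distrib]

theorem rowSum_single (i a : Fin m) (j : Fin n) :
    rowSum (Matrix.single i j 1) a = if a = i then 1 else 0 := by
  simp only [rowSum, Matrix.single_apply]
  by_cases h : a = i
  · simp [h]
  · simp [h, Ne.symm h]

theorem colSum_single (i : Fin m) (j b : Fin n) :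
    colSum (Matrix.single i j 1) b = if b = j then 1 else 0 := by
  simp only [colSum, Matrix.single_apply]
  by_cases h : b = j
  · simp [h]
  · simp [h, Ne.symm h]

theorem entrySum_eq_sum_rowSum (A : Matrix (Fin m) (Fin n) ℕ) :
    entrySum A = ∑ i, rowSum A i := rfl

theorem entrySum_eq_sum_colSum (A : Matrix (Fin m) (Fin n) ℕ) :
    entrySum A = ∑ j, colSum A j := sum_comm

theorem IsZeroOne.eq_of_lt {A B : Matrix (Fin m) (Fin n) ℕ} (hA : IsZeroOne A)
    (hB : IsZeroOne B) {i i' : Fin m} {j j' : Fin n} (h : B i' j' < A i j) :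
    A i j = 1 ∧ B i' j' = 0 := by
  have := hA i j
  have := hB i' j'
  omega

theorem exists_eq_of_rowSum_lt {A B : Matrix (Fin m) (Fin n) ℕ} (hA : IsZeroOne A)
    (hB : IsZeroOne B) {i i' : Fin m} (h : rowSum B i' < rowSum A i) :
    ∃ j, A i j = 1 ∧ B i' j = 0 := by
  obtain ⟨j, -, hj⟩ := exists_lt_of_sum_lt h
  exact ⟨j, hA.eq_of_lt hB hj⟩

theorem exists_eq_of_colSum_lt {A B : Matrix (Fin m) (Fin n) ℕ} (hA : IsZeroOne A)
    (hB : IsZeroOne B) {j j' : Fin n} (h : colSum B j' < colSum A j) :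
    ∃ i, A i j = 1 ∧ B i j' = 0 := by
  obtain ⟨i, -, hi⟩ := exists_lt_of_sum_lt h
  exact ⟨i, hA.eq_of_lt hB hi⟩

/-- A `1` of a `(0,1)`-matrix can be erased. -/
theorem IsZeroOne.exists_erase {A : Matrix (Fin m) (Fin n) ℕ} (hA : IsZeroOne A)
    {i : Fin m} {j : Fin n} (h : A i j = 1) :
    ∃ A', IsZeroOne A' ∧ A' + Matrix.single i j 1 = A := by
  refine ⟨A - Matrix.single i j 1, fun a b => ?_, ?_⟩
  · have := hA a b
    simp only [Matrix.sub_apply]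
    omega
  · ext a b
    simp only [Matrix.sub_apply, Matrix.add_apply, Matrix.single_apply]
    split_ifs with hab
    · obtain ⟨rfl, rfl⟩ := hab
      omega
    · omega

/-- A `1` of a `(0,1)`-matrix can be moved to the place of a `0`. -/
theorem IsZeroOne.exists_move {A : Matrix (Fin m) (Fin n) ℕ} (hA : IsZeroOne A)
    {i i' : Fin m} {j j' : Fin n} (h : A i j = 1) (h' : A i' j' = 0) :
    ∃ A', IsZeroOne A' ∧ A' + Matrix.single i j 1 = A + Matrix.single i' j' 1 := by
  obtain ⟨A₁, hA₁, h₁⟩ := hA.exists_erase h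
  have hz : A₁ i' j' = 0 := by
    have := congrFun (congrFun h₁ i') j'
    rw [Matrix.add_apply] at this
    omega
  refine ⟨A₁ + Matrix.single i' j' 1, fun a b => ?_, ?_⟩
  · simp only [Matrix.add_apply, Matrix.single_apply]
    split_ifs with hab
    · obtain ⟨rfl, rfl⟩ := hab
      omega
    · simpa using hA₁ a b
  · rw [← h₁]
    abel

end Sums

/-! ### Alternating walks and augmentation -/

section Augmentation

variable {m n : ℕ}

/-- From a row where `C` has more `1`s than `D`, an alternating walk through the positions where
`C` and `D` differ leads to a column where `C` has more `1`s, or to a row where `C` has fewer.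
`C'` is the result of flipping `C` along that walk; it agrees everywhere with `C` or with `D`. -/
theorem exists_alternating_walk {C D : Matrix (Fin m) (Fin n) ℕ} (hC : IsZeroOne C)
    (hD : IsZeroOne D) {i : Fin m} (hi : rowSum D i < rowSum C i) :
    ∃ C', IsZeroOne C' ∧ (∀ a b, C' a b = C a b ∨ C' a b = D a b) ∧
      ((∃ j, colSum D j < colSum C j ∧
          (∀ a, rowSum C' a + (if a = i then 1 else 0) = rowSum C a) ∧
          ∀ b, colSum C' b + (if b = j then 1 else 0) = colSum C b) ∨
        ∃ i', rowSum C i' < rowSum D i' ∧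
          (∀ a, rowSum C' a + (if a = i then 1 else 0) =
            rowSum C a + (if a = i' then 1 else 0)) ∧
          ∀ b, colSum C' b = colSum C b) := by
  induction hN : #{p : Fin m × Fin n | C p.1 p.2 ≠ D p.1 p.2} using Nat.strong_induction_on
    generalizing C i with
  | _ N ih =>
  subst hN
  obtain ⟨j, hCj, hDj⟩ := exists_eq_of_rowSum_lt hC hD hi
  by_cases hj : colSum D j < colSum C j
  · obtain ⟨C', hC', h⟩ := hC.exists_erase hCj
    refine ⟨C', hC', fun a b => ?_, Or.inl ⟨j, hj, fun a => ?_, fun b => ?_⟩⟩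
    · have := congrFun (congrFun h a) b
      rw [Matrix.add_apply, Matrix.single_apply] at this
      split_ifs at this with hab
      · obtain ⟨rfl, rfl⟩ := hab
        omega
      · omega
    · rw [← h, rowSum_add, rowSum_single]
    · rw [← h, colSum_add, colSum_single]
  obtain ⟨k, hDk, hCk⟩ : ∃ k, D k j = 1 ∧ C k j = 0 := by
    by_contra! hcon
    refine hj (sum_lt_sum (fun a _ => ?_) ⟨i, mem_univ i, by omega⟩)
    have := hC a j
    have := hD a j
    have := hcon a
    omega
  obtain ⟨C₁, hC₁, h₁⟩ := hC.exists_move hCj hCk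
  have hik : i ≠ k := by
    rintro rfl
    omega
  have hrow : ∀ a, rowSum C₁ a + (if a = i then 1 else 0) =
      rowSum C a + (if a = k then 1 else 0) := fun a => by
    rw [← rowSum_single i a j, ← rowSum_add, h₁, rowSum_add, rowSum_single]
  have hcol : ∀ b, colSum C₁ b = colSum C b := fun b => by
    have := congrArg (colSum · b) h₁
    simpa only [colSum_add, colSum_single, Nat.add_right_cancel_iff] using this
  have hent : ∀ a b, C₁ a b + (if i = a ∧ j = b then 1 else 0) =
      C a b + (if k = a ∧ j = b then 1 else 0) := fun a b => by
    simpa only [Matrix.add_apply, Matrix.single_apply] using congrFun (congrFun h₁ a) b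
  have hloc : ∀ a b, C₁ a b = C a b ∨ C₁ a b = D a b := fun a b => by
    have := hent a b
    split_ifs at this with h1 h2 h2
    · omega
    · obtain ⟨rfl, rfl⟩ := h1
      omega
    · obtain ⟨rfl, rfl⟩ := h2
      omega
    · omega
  by_cases hk : rowSum C k < rowSum D k
  · exact ⟨C₁, hC₁, hloc, Or.inr ⟨k, hk, hrow, hcol⟩⟩
  have hk₁ : rowSum D k < rowSum C₁ k := by
    have := hrow k
    rw [if_neg hik.symm, if_pos rfl] at this
    omega
  have hlt : #{p : Fin m × Fin n | C₁ p.1 p.2 ≠ D p.1 p.2} <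
      #{p : Fin m × Fin n | C p.1 p.2 ≠ D p.1 p.2} := by
    refine card_lt_card (ssubset_iff_of_subset (fun p hp => ?_) |>.2 ⟨(i, j), ?_, ?_⟩)
    · simp only [mem_filter, mem_univ, true_and] at hp ⊢
      have := hloc p.1 p.2
      omega
    · simp [hCj, hDj]
    · have := hent i j
      simp only [and_self, if_true, hik.symm, false_and, if_false] at this
      simp only [mem_filter, mem_univ, true_and, not_not]
      omega
  obtain ⟨C', hC', hloc', hend⟩ := ih _ hlt hC₁ hk₁ rfl
  refine ⟨C', hC', fun a b => ?_, ?_⟩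
  · rcases hloc' a b with h | h
    · rw [h]
      exact hloc a b
    · exact Or.inr h
  rcases hend with ⟨j', hj', hr, hc⟩ | ⟨i', hi', hr, hc⟩
  · refine Or.inl ⟨j', by rwa [← hcol], fun a => ?_, fun b => by rw [hc, hcol]⟩
    have := hr a
    have := hrow a
    omega
  · have hne : i' ≠ i := by
      rintro rfl
      have := hrow i'
      rw [if_pos rfl, if_neg hik] at this
      omega
    refine Or.inr ⟨i', ?_, fun a => ?_, fun b => by rw [hc, hcol]⟩
    · have := hrow i'
      rw [if_neg hne] at this
      omega
    · have := hr a
      have := hrow a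
      omega

/-- If `C` has more `1`s than `D`, then one `1` can be removed from a row and from a column in
each of which `C` exceeds `D`, without changing the other row and column sums of `C`. -/
theorem exists_augmentation {C D : Matrix (Fin m) (Fin n) ℕ} (hC : IsZeroOne C)
    (hD : IsZeroOne D) (h : entrySum D < entrySum C) :
    ∃ C' i j, IsZeroOne C' ∧ rowSum D i < rowSum C i ∧ colSum D j < colSum C j ∧
      (∀ a, rowSum C' a + (if a = i then 1 else 0) = rowSum C a) ∧
      ∀ b, colSum C' b + (if b = j then 1 else 0) = colSum C b := by
  induction hN : #{p : Fin m × Fin n | C p.1 p.2 ≠ D p.1 p.2} using Nat.strong_induction_on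
    generalizing D with
  | _ N ih =>
  subst hN
  obtain ⟨i, -, hi⟩ : ∃ i ∈ univ, rowSum D i < rowSum C i := exists_lt_of_sum_lt h
  obtain ⟨C', hC', hloc, ⟨j, hj, hr, hc⟩ | ⟨k, hk, hr, hc⟩⟩ := exists_alternating_walk hC hD hi
  · exact ⟨C', i, j, hC', hi, hj, hr, hc⟩
  -- The walk ends in a row: flip `D` instead of `C` along it, which brings `D` closer to `C`.
  obtain ⟨D', hD'⟩ : ∃ D' : Matrix (Fin m) (Fin n) ℕ, D' + C' = C + D := by
    refine ⟨C + D - C', ?_⟩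
    ext a b
    have := hloc a b
    simp only [Matrix.add_apply, Matrix.sub_apply]
    omega
  have hent : ∀ a b, D' a b + C' a b = C a b + D a b := fun a b => congrFun (congrFun hD' a) b
  have hrow : ∀ a, rowSum D' a + (if a = k then 1 else 0) =
      rowSum D a + (if a = i then 1 else 0) := fun a => by
    have h1 := congrArg (rowSum · a) hD'
    simp only [rowSum_add] at h1
    have := hr a
    omega
  have hcol : ∀ b, colSum D' b = colSum D b := fun b => by
    have h1 := congrArg (colSum · b) hD'
    simp only [colSum_add] at h1
    have := hc b
    omega
  have hD'01 : IsZeroOne D' := fun a b => by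
    have := hent a b
    have := hloc a b
    have := hC a b
    have := hD a b
    omega
  have hik : i ≠ k := by
    rintro rfl
    omega
  obtain ⟨b, hb⟩ : ∃ b, C' i b ≠ C i b := by
    by_contra! hcon
    have h1 : rowSum C' i = rowSum C i := sum_congr rfl fun b _ => hcon b
    have := hr i
    rw [if_pos rfl, if_neg hik] at this
    omega
  have hlt : #{p : Fin m × Fin n | C p.1 p.2 ≠ D' p.1 p.2} <
      #{p : Fin m × Fin n | C p.1 p.2 ≠ D p.1 p.2} := by
    refine card_lt_card (ssubset_iff_of_subset (fun p hp => ?_) |>.2 ⟨(i, b), ?_, ?_⟩)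
    · simp only [mem_filter, mem_univ, true_and] at hp ⊢
      have := hloc p.1 p.2
      have := hent p.1 p.2
      omega
    · have := hloc i b
      simp only [mem_filter, mem_univ, true_and]
      omega
    · have := hloc i b
      have := hent i b
      simp only [mem_filter, mem_univ, true_and]
      omega
  have hsum : entrySum D' < entrySum C := by
    rw [entrySum_eq_sum_colSum] at h ⊢
    simpa only [hcol] using h
  obtain ⟨C'', i₀, j₀, hC'', hi₀, hj₀, hr', hc'⟩ := ih _ hlt hD'01 hsum rfl
  refine ⟨C'', i₀, j₀, hC'', ?_, by rwa [← hcol], hr', hc'⟩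
  have h1 := hrow i₀
  by_cases hik₀ : i₀ = k
  · subst hik₀
    rw [if_pos rfl, if_neg hik.symm] at h1
    omega
  · rw [if_neg hik₀] at h1
    omega

end Augmentation

/-! ### Joint realization -/

section Joint

variable {m n : ℕ} {R : Fin m → ℕ} {S : Fin n → ℕ}

/-- Let `C` have row sums at most `R`, and column sums at most `S` that fall short of `S` by at
most `1`. Then some matrix with the row and column sums of `C` lies below a matrix of the class of
`R` and `S`. -/
theorem exists_le_of_colSum_le {C : Matrix (Fin m) (Fin n) ℕ} (hC : IsZeroOne C)
    (hne : (matrixClass R S).Nonempty) (hr : ∀ i, rowSum C i ≤ R i)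
    (hc : ∀ j, colSum C j ≤ S j ∧ S j ≤ colSum C j + 1) :
    ∃ A ∈ matrixClass R S, ∃ C', IsZeroOne C' ∧ (∀ i, rowSum C' i = rowSum C i) ∧
      (∀ j, colSum C' j = colSum C j) ∧ ∀ i j, C' i j ≤ A i j := by
  obtain ⟨A₀, hA₀⟩ := hne
  -- A pair with the largest overlap works; by `C' ≤ 1` the overlap is at most `entrySum C`.
  obtain ⟨⟨A, C'⟩, ⟨hA, hC', hrC, hcC⟩, hmin⟩ := exists_forall_le_of_exists
    (fun q : Matrix (Fin m) (Fin n) ℕ × Matrix (Fin m) (Fin n) ℕ =>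
      entrySum C - ∑ a, ∑ b, q.1 a b * q.2 a b)
    (p := fun q => q.1 ∈ matrixClass R S ∧ IsZeroOne q.2 ∧ (∀ i, rowSum q.2 i = rowSum C i) ∧
      ∀ j, colSum q.2 j = colSum C j)
    ⟨(A₀, C), hA₀, hC, fun _ => rfl, fun _ => rfl⟩
  dsimp only at hA hC' hrC hcC hmin
  refine ⟨A, hA, C', hC', hrC, hcC, ?_⟩
  have hmax : ∀ A₁ C₁, A₁ ∈ matrixClass R S → IsZeroOne C₁ → (∀ i, rowSum C₁ i = rowSum C i) →
      (∀ j, colSum C₁ j = colSum C j) →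
      ∑ a, ∑ b, A₁ a b * C₁ a b ≤ ∑ a, ∑ b, A a b * C' a b := by
    intro A₁ C₁ hA₁ hC₁ hr₁ hc₁
    have h1 := hmin (A₁, C₁) ⟨hA₁, hC₁, hr₁, hc₁⟩
    have h2 : ∑ a, ∑ b, A₁ a b * C₁ a b ≤ entrySum C := by
      have h3 : entrySum C₁ = entrySum C := sum_congr rfl fun a _ => hr₁ a
      rw [← h3]
      refine sum_le_sum fun a _ => sum_le_sum fun b _ => ?_
      rcases hA₁.1 a b with h | h <;> simp [h]
    dsimp only at h1
    omega
  by_contra! hbad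
  obtain ⟨i, j, hij⟩ := hbad
  obtain ⟨hCij, hAij⟩ := hC'.eq_of_lt hA.1 hij
  obtain ⟨k, hAk, hCk⟩ : ∃ k, A i k = 1 ∧ C' i k = 0 := by
    by_contra! hcon
    have h1 : rowSum A i < rowSum C' i := by
      refine sum_lt_sum (fun b _ => ?_) ⟨j, mem_univ j, by omega⟩
      have := hA.1 i b
      have := hC' i b
      have := hcon b
      omega
    have := hA.2.1 i
    have := hr i
    have := hrC i
    omega
  have hjk : j ≠ k := by
    rintro rfl
    omega
  -- The column deficits in `j` and `k` differ by at most `1`, while row `i` contributes `2` to the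
  -- difference, so some row `l` is unbalanced in the opposite direction.
  obtain ⟨l, hl⟩ : ∃ l, A l k + C' l j < A l j + C' l k := by
    by_contra! hcon
    have h1 : ∑ a, (A a j + C' a k) + 2 ≤ ∑ a, (A a k + C' a j) := by
      have h2 : ∀ a, A a j + C' a k + (if a = i then 2 else 0) ≤ A a k + C' a j := fun a => by
        split_ifs with ha
        · subst ha
          omega
        · exact hcon a
      have h3 := sum_le_sum fun a (_ : a ∈ univ) => h2 a
      rw [sum_add_distrib] at h3
      simpa using h3
    simp only [sum_add_distrib] at h1
    have e1 := hA.2.2 j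
    have e2 := hA.2.2 k
    have e3 := hcC j
    have e4 := hcC k
    have e5 := hc j
    have e6 := hc k
    simp only [colSum] at e1 e2 e3 e4 e5 e6
    omega
  have hli : l ≠ i := by
    rintro rfl
    omega
  have swap : ∀ M : Matrix (Fin m) (Fin n) ℕ, IsZeroOne M → ∀ j k : Fin n, j ≠ k →
      M i j = 0 → M i k = 1 → M l j = 1 → M l k = 0 →
      ∃ M', IsZeroOne M' ∧ (∀ a, rowSum M' a = rowSum M a) ∧ (∀ b, colSum M' b = colSum M b) ∧
        M' + Matrix.single i k 1 + Matrix.single l j 1 =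
          M + Matrix.single i j 1 + Matrix.single l k 1 := by
    intro M hM j k hjk h1 h2 h3 h4
    obtain ⟨M₁, hM₁, e₁⟩ := hM.exists_move h2 h1
    have e₁' : ∀ b, M₁ l b = M l b := fun b => by
      have := congrFun (congrFun e₁ l) b
      simpa [Matrix.single_apply, hli.symm] using this
    obtain ⟨M₂, hM₂, e₂⟩ := hM₁.exists_move ((e₁' j).trans h3) ((e₁' k).trans h4)
    have e : M₂ + Matrix.single i k 1 + Matrix.single l j 1 =
        M + Matrix.single i j 1 + Matrix.single l k 1 := by
      rw [add_right_comm, e₂, add_right_comm, e₁]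
    refine ⟨M₂, hM₂, fun a => ?_, fun b => ?_, e⟩
    · have := congrArg (rowSum · a) e
      simp only [rowSum_add, rowSum_single] at this
      omega
    · have := congrArg (colSum · b) e
      simp only [colSum_add, colSum_single] at this
      omega
  have overlap : ∀ M N : Matrix (Fin m) (Fin n) ℕ, ∀ a₀ b₀,
      ∑ a, ∑ b, (M + Matrix.single a₀ b₀ 1 : Matrix (Fin m) (Fin n) ℕ) a b * N a b =
        ∑ a, ∑ b, M a b * N a b + N a₀ b₀ := by
    intro M N a₀ b₀
    simp only [Matrix.add_apply, add_mul, sum_add_distrib, Nat.add_left_cancel_iff]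
    rw [sum_eq_single a₀ (fun a _ ha => by simp [ha.symm]) (by simp),
      sum_eq_single b₀ (fun b _ hb => by simp [hb.symm]) (by simp)]
    simp
  have hA1 := hA.1 l j
  have hA2 := hA.1 l k
  have hC1 := hC' l j
  have hC2 := hC' l k
  -- Row `l` allows `A` or `C'` to be swapped on rows `i`, `l` and columns `j`, `k`, and this
  -- increases the overlap.
  by_cases hcase : A l j = 1 ∧ A l k = 0
  · obtain ⟨A₁, hA₁, hr₁, hc₁, e⟩ := swap A hA.1 j k hjk hAij hAk hcase.1 hcase.2
    have h1 := hmax A₁ C' ⟨hA₁, fun a => (hr₁ a).trans (hA.2.1 a),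
      fun b => (hc₁ b).trans (hA.2.2 b)⟩ hC' hrC hcC
    have h2 := congrArg (fun M : Matrix (Fin m) (Fin n) ℕ => ∑ a, ∑ b, M a b * C' a b) e
    simp only [overlap] at h2
    omega
  · obtain ⟨C₁, hC₁, hr₁, hc₁, e⟩ := swap C' hC' k j hjk.symm hCk hCij (by omega) (by omega)
    have h1 := hmax A C₁ hA hC₁ (fun a => (hr₁ a).trans (hrC a)) (fun b => (hc₁ b).trans (hcC b))
    have h2 := congrArg (fun M : Matrix (Fin m) (Fin n) ℕ => ∑ a, ∑ b, M a b * A a b) e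
    simp only [overlap] at h2
    simp only [mul_comm (A _ _)] at h1
    omega

/-- If `S` is nonincreasing, the columns where the column sums of `C` fall short of `S` can be taken
to be the first ones. -/
theorem exists_colSum_add_eq {C : Matrix (Fin m) (Fin n) ℕ} (hC : IsZeroOne C) (hS : Antitone S)
    (hc : ∀ j, colSum C j ≤ S j ∧ S j ≤ colSum C j + 1) {N : ℕ}
    (hN : entrySum C + N = ∑ j, S j) :
    ∃ C', IsZeroOne C' ∧ (∀ i, rowSum C' i = rowSum C i) ∧
      ∀ j, colSum C' j + (if (j : ℕ) < N then 1 else 0) = S j := by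
  obtain ⟨C', ⟨hC', hr, hc'⟩, hmin⟩ := exists_forall_le_of_exists
    (fun M : Matrix (Fin m) (Fin n) ℕ =>
      ∑ j : Fin n, (j : ℕ) * S j - ∑ j : Fin n, (j : ℕ) * colSum M j)
    (p := fun M => IsZeroOne M ∧ (∀ i, rowSum M i = rowSum C i) ∧
      ∀ j, colSum M j ≤ S j ∧ S j ≤ colSum M j + 1)
    ⟨C, hC, fun _ => rfl, hc⟩
  refine ⟨C', hC', hr, ?_⟩
  -- A deficit in a column `k` but not in an earlier column `j` could be moved to `j`, because
  -- then column `j` of `C'` has a larger sum than column `k`.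
  have hlow : ∀ j k, j ≤ k → colSum C' k < S k → colSum C' j < S j := by
    intro j k hjk hk
    by_contra hj
    have hjk' : j < k := lt_of_le_of_ne hjk (by rintro rfl; exact hj hk)
    have h1 := hS hjk
    obtain ⟨i, hij, hik⟩ := exists_eq_of_colSum_lt (j := j) (j' := k) hC' hC' (by omega)
    obtain ⟨M, hM, e⟩ := hC'.exists_move hij hik
    have hrM : ∀ a, rowSum M a = rowSum C' a := fun a => by
      have := congrArg (rowSum · a) e
      simpa only [rowSum_add, rowSum_single, Nat.add_right_cancel_iff] using this
    have hcM : ∀ b, colSum M b + (if b = j then 1 else 0) =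
        colSum C' b + (if b = k then 1 else 0) := fun b => by
      simpa only [colSum_add, colSum_single] using congrArg (colSum · b) e
    have hM' : ∀ b, colSum M b ≤ S b ∧ S b ≤ colSum M b + 1 := fun b => by
      have := hcM b
      have := hc' b
      have := hc' j
      split_ifs at * <;> subst_vars <;> omega
    have h2 := hmin M ⟨hM, fun a => (hrM a).trans (hr a), hM'⟩
    have h3 : ∑ b : Fin n, (b : ℕ) * colSum M b ≤ ∑ b : Fin n, (b : ℕ) * S b :=
      sum_le_sum fun b _ => Nat.mul_le_mul_left _ (hM' b).1
    have h4 : ∑ b : Fin n, (b : ℕ) * colSum M b + j = ∑ b : Fin n, (b : ℕ) * colSum C' b + k := by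
      have h5 : ∑ b : Fin n, (b : ℕ) * (colSum M b + (if b = j then 1 else 0)) =
          ∑ b : Fin n, (b : ℕ) * (colSum C' b + (if b = k then 1 else 0)) :=
        sum_congr rfl fun b _ => by rw [hcM]
      simpa [mul_add, sum_add_distrib] using h5
    have h6 : (j : ℕ) < k := hjk'
    omega
  have hcard : #{j | colSum C' j < S j} = N := by
    have h1 : ∀ j, colSum C' j + (if colSum C' j < S j then 1 else 0) = S j := fun j => by
      have := hc' j
      split_ifs <;> omega
    have h2 : ∑ j, (colSum C' j + (if colSum C' j < S j then 1 else 0)) = ∑ j, S j :=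
      sum_congr rfl fun j _ => h1 j
    have h3 : entrySum C' = entrySum C := sum_congr rfl fun i _ => hr i
    rw [sum_add_distrib, ← entrySum_eq_sum_colSum, ← card_filter, ← hN, h3] at h2
    omega
  intro j
  have h1 := iff_lt_card_filter (fun j => colSum C' j < S j) hlow j
  rw [hcard] at h1
  have := hc' j
  split_ifs with h <;> omega

end Joint

/-! ### The polymatroid of row sum vectors of selections -/

section Polymatroid

variable {m n : ℕ} {R : Fin m → ℕ} {S : Fin n → ℕ}

/-- The vectors `x` for which some `(0,1)`-matrix has row sum vector `R - x` and column sums equal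
to or one less than those of `S`. If the class of `R` and `S` is nonempty, they are the row sum
vectors of the matrices `B ≤ A` with column sums at most `1`, for `A` in the class. -/
def IsRowVector (R : Fin m → ℕ) (S : Fin n → ℕ) (x : Fin m → ℕ) : Prop :=
  ∃ C : Matrix (Fin m) (Fin n) ℕ, IsZeroOne C ∧ (∀ i, rowSum C i + x i = R i) ∧
    ∀ j, colSum C j ≤ S j ∧ S j ≤ colSum C j + 1

theorem sum_eq_sum_of_nonempty (hne : (matrixClass R S).Nonempty) : ∑ i, R i = ∑ j, S j := by
  obtain ⟨A, -, hr, hc⟩ := hne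
  rw [← sum_congr rfl fun i _ => hr i, ← sum_congr rfl fun j _ => hc j]
  exact sum_comm

theorem isRowVector_of_selection {A B : Matrix (Fin m) (Fin n) ℕ} {t : ℕ}
    (hA : A ∈ matrixClass R S) (hB : IsSelection t A B) : IsRowVector R S (rowSum B) := by
  have e : A - B + B = A := by
    ext i j
    simpa using Nat.sub_add_cancel (hB.2.1 i j)
  refine ⟨A - B, fun i j => ?_, fun i => ?_, fun j => ?_⟩
  · have := hA.1 i j
    simp only [Matrix.sub_apply]
    omega
  · rw [← rowSum_add, e, hA.2.1]
  · have h1 := hA.2.2 j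
    rw [← e, colSum_add] at h1
    have := hB.2.2.2 j
    omega

/-- Every vector of `IsRowVector R S` is the row sum vector of a selection, and the columns used by
the selection can be taken to be the first ones. -/
theorem IsRowVector.exists_selection {x : Fin m → ℕ} (hx : IsRowVector R S x)
    (hne : (matrixClass R S).Nonempty) (hS : Antitone S) :
    ∃ A ∈ matrixClass R S, ∃ B, IsZeroOne B ∧ (∀ i j, B i j ≤ A i j) ∧
      (∀ i, rowSum B i = x i) ∧ ∀ j, colSum B j = if (j : ℕ) < ∑ i, x i then 1 else 0 := by
  obtain ⟨C, hC, hr, hc⟩ := hx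
  have hN : entrySum C + ∑ i, x i = ∑ j, S j := by
    rw [entrySum_eq_sum_rowSum, ← sum_add_distrib, sum_congr rfl fun i _ => hr i,
      sum_eq_sum_of_nonempty hne]
  obtain ⟨C₁, hC₁, hr₁, hc₁⟩ := exists_colSum_add_eq hC hS hc hN
  obtain ⟨A, hA, C₂, hC₂, hr₂, hc₂, hle⟩ := exists_le_of_colSum_le (R := R) (S := S) hC₁ hne
    (fun i => by have := hr i; rw [hr₁]; omega)
    (fun j => by have := hc₁ j; split_ifs at this <;> omega)
  have e : A - C₂ + C₂ = A := by
    ext i j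
    simpa using Nat.sub_add_cancel (hle i j)
  refine ⟨A, hA, A - C₂, fun i j => ?_, fun i j => Nat.sub_le _ _, fun i => ?_, fun j => ?_⟩
  · have := hA.1 i j
    simp only [Matrix.sub_apply]
    omega
  · have h1 := hA.2.1 i
    rw [← e, rowSum_add, hr₂, hr₁] at h1
    have := hr i
    omega
  · have h1 := hA.2.2 j
    rw [← e, colSum_add, hc₂, ← hc₁ j] at h1
    omega

/-- The augmentation property of an integral polymatroid. -/
theorem IsRowVector.exists_augment {x y : Fin m → ℕ} (hx : IsRowVector R S x)
    (hy : IsRowVector R S y) (h : ∑ i, x i < ∑ i, y i) :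
    ∃ i, x i < y i ∧ IsRowVector R S (fun a => x a + if a = i then 1 else 0) := by
  obtain ⟨C, hC, hrC, hcC⟩ := hx
  obtain ⟨D, hD, hrD, hcD⟩ := hy
  have hlt : entrySum D < entrySum C := by
    have h1 : ∑ i, (rowSum C i + x i) = ∑ i, (rowSum D i + y i) :=
      sum_congr rfl fun i _ => (hrC i).trans (hrD i).symm
    rw [sum_add_distrib, sum_add_distrib] at h1
    rw [entrySum_eq_sum_rowSum, entrySum_eq_sum_rowSum]
    omega
  obtain ⟨C', i, j, hC', hi, hj, hr, hc⟩ := exists_augmentation hC hD hlt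
  refine ⟨i, ?_, C', hC', fun a => ?_, fun b => ?_⟩
  · have := hrC i
    have := hrD i
    omega
  · have := hrC a
    have := hr a
    dsimp only
    omega
  · have h1 := hc b
    have h2 := hcC b
    split_ifs at h1 with hb
    · subst hb
      have := hcD b
      omega
    · omega

/-- Since `R` is nonincreasing, an increase of `x` from row `i` to a later row `k` can be
reduced by moving a unit of `x` from `k` to `i`. -/
theorem IsRowVector.exists_transfer {x : Fin m → ℕ} (hx : IsRowVector R S x) (hR : Antitone R)
    {i k : Fin m} (hik : i ≤ k) (h : x i < x k) :
    ∃ y, IsRowVector R S y ∧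
      ∀ a, y a + (if a = k then 1 else 0) = x a + if a = i then 1 else 0 := by
  obtain ⟨C, hC, hr, hc⟩ := hx
  have h1 := hR hik
  have h2 := hr i
  have h3 := hr k
  obtain ⟨j, hij, hkj⟩ := exists_eq_of_rowSum_lt (i := i) (i' := k) hC hC (by omega)
  obtain ⟨M, hM, e⟩ := hC.exists_move hij hkj
  have hrM : ∀ a, rowSum M a + (if a = i then 1 else 0) =
      rowSum C a + (if a = k then 1 else 0) := fun a => by
    simpa only [rowSum_add, rowSum_single] using congrArg (rowSum · a) e
  have hcM : ∀ b, colSum M b = colSum C b := fun b => by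
    have := congrArg (colSum · b) e
    simpa only [colSum_add, colSum_single, Nat.add_right_cancel_iff] using this
  have hxa : ∀ a, (if a = k then 1 else 0) ≤ x a := fun a => by
    split_ifs with ha
    · subst ha
      omega
    · omega
  refine ⟨fun a => x a + (if a = i then 1 else 0) - if a = k then 1 else 0,
    ⟨M, hM, fun a => ?_, fun b => by rw [hcM]; exact hc b⟩, fun a => ?_⟩
  · have := hrM a
    have := hr a
    have := hxa a
    dsimp only
    omega
  · have := hxa a
    dsimp only
    omega

end Polymatroid

/-! ### Simultaneous maximality -/

section Maximal

variable {m n : ℕ} {R : Fin m → ℕ} {S : Fin n → ℕ}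

theorem exists_le_rowSum_eq {B : Matrix (Fin m) (Fin n) ℕ} {y : Fin m → ℕ} (hB : IsZeroOne B)
    (hy : ∀ i, y i ≤ rowSum B i) :
    ∃ B', IsZeroOne B' ∧ (∀ i j, B' i j ≤ B i j) ∧ ∀ i, rowSum B' i = y i := by
  have hcard : ∀ i, rowSum B i = #{j | B i j = 1} := fun i => by
    rw [card_filter]
    refine sum_congr rfl fun j _ => ?_
    rcases hB i j with h | h <;> simp [h]
  choose T hT hTc using fun i => exists_subset_card_eq ((hy i).trans_eq (hcard i))
  refine ⟨fun i j => if j ∈ T i then 1 else 0, fun i j => ?_, fun i j => ?_, fun i => ?_⟩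
  · dsimp only
    split_ifs <;> simp
  · dsimp only
    split_ifs with h
    · have := hT i h
      simp only [mem_filter, mem_univ, true_and] at this
      exact this.ge
    · exact Nat.zero_le _
  · rw [← hTc i]
    simp [rowSum]

theorem sum_min_rowSum_le_termRank {A B : Matrix (Fin m) (Fin n) ℕ} (hB : IsZeroOne B)
    (hle : ∀ i j, B i j ≤ A i j) (hc : ∀ j, colSum B j ≤ 1) (k : ℕ) :
    ∑ i, min (rowSum B i) k ≤ termRank k A := by
  obtain ⟨B', hB', hle', hr⟩ := exists_le_rowSum_eq (y := fun i => min (rowSum B i) k) hB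
    fun i => min_le_left _ _
  refine (termRank_isGreatest k A).2 ⟨B', ⟨hB', fun i j => (hle' i j).trans (hle i j),
    fun i => (hr i).trans_le (min_le_right _ _), fun j => ?_⟩, ?_⟩
  · exact (sum_le_sum fun i _ => hle' i j).trans (hc j)
  · exact sum_congr rfl fun i _ => hr i

theorem IsRowVector.sum_min_le {x : Fin m → ℕ} (hx : IsRowVector R S x)
    (hne : (matrixClass R S).Nonempty) (hS : Antitone S) (k : ℕ) :
    ∑ i, min (x i) k ≤ maxTermRank k R S := by
  obtain ⟨A, hA, B, hB, hle, hr, hc⟩ := hx.exists_selection hne hS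
  have h1 := sum_min_rowSum_le_termRank hB hle
    (fun j => by rw [hc]; split_ifs <;> simp) k
  simp only [hr] at h1
  exact h1.trans ((maxTermRank_isGreatest k R S hne).2 ⟨A, hA, rfl⟩)

theorem exists_isRowVector_sum_eq (hne : (matrixClass R S).Nonempty) (k : ℕ) :
    ∃ x, IsRowVector R S x ∧ (∀ i, x i ≤ k) ∧ ∑ i, x i = maxTermRank k R S := by
  obtain ⟨A, hA, hAk⟩ := (maxTermRank_isGreatest k R S hne).1
  obtain ⟨B, hB, hBk⟩ := (termRank_isGreatest k A).1
  exact ⟨rowSum B, isRowVector_of_selection hA hB, hB.2.2.1, hBk.trans hAk⟩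

/-- A single vector whose truncations at all levels `k ≤ t` have the maximum possible sum. -/
theorem exists_isRowVector_forall_sum_min_eq (hne : (matrixClass R S).Nonempty) (hS : Antitone S)
    (t : ℕ) : ∃ x, IsRowVector R S x ∧ (∀ i, x i ≤ t) ∧
      ∀ k ≤ t, ∑ i, min (x i) k = maxTermRank k R S := by
  induction t with
  | zero =>
    obtain ⟨x, hx, hle, hsum⟩ := exists_isRowVector_sum_eq hne 0
    refine ⟨x, hx, hle, fun k hk => ?_⟩
    obtain rfl : k = 0 := by omega
    rw [← hsum]
    exact sum_congr rfl fun i _ => min_eq_left (hle i)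
  | succ t ih =>
    obtain ⟨x, hx, hxt, hxk⟩ := ih
    obtain ⟨y, hy, hyt, hysum⟩ := exists_isRowVector_sum_eq (R := R) (S := S) hne (t + 1)
    -- Augment `x` as long as possible, keeping all its entries at most `t + 1`.
    obtain ⟨z, ⟨hz, hxz, hzt⟩, hmin⟩ := exists_forall_le_of_exists
      (fun z : Fin m → ℕ => maxTermRank (t + 1) R S - ∑ i, z i)
      (p := fun z => IsRowVector R S z ∧ (∀ i, x i ≤ z i) ∧ ∀ i, z i ≤ t + 1)
      ⟨x, hx, fun _ => le_rfl, fun i => (hxt i).trans t.le_succ⟩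
    have hzsum : ∑ i, min (z i) (t + 1) = maxTermRank (t + 1) R S := by
      refine le_antisymm (hz.sum_min_le hne hS _) ?_
      rw [sum_congr rfl fun i _ => min_eq_left (hzt i)]
      by_contra! hlt
      obtain ⟨i, hi, hz'⟩ := hz.exists_augment hy (hlt.trans_eq hysum.symm)
      have h1 := hmin _ ⟨hz', fun a => (hxz a).trans (Nat.le_add_right _ _), fun a => by
        have := hyt a
        have := hzt a
        split_ifs with ha
        · subst ha
          omega
        · omega⟩
      simp only [sum_add_distrib, sum_ite_eq', mem_univ, if_true] at h1
      change ∑ i, z i < _ at hlt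
      omega
    refine ⟨z, hz, hzt, fun k hk => ?_⟩
    obtain rfl | hk := hk.eq_or_lt
    · exact hzsum
    · refine le_antisymm (hz.sum_min_le hne hS k) ?_
      rw [← hxk k (by omega)]
      exact sum_le_sum fun i _ => min_le_min_right k (hxz i)

/-- The vector of `exists_isRowVector_forall_sum_min_eq` can be taken nonincreasing: transfers to
earlier rows do not decrease the sums of the truncations. -/
theorem exists_antitone_isRowVector (hne : (matrixClass R S).Nonempty) (hR : Antitone R)
    (hS : Antitone S) (t : ℕ) : ∃ x, IsRowVector R S x ∧ Antitone x ∧ (∀ i, x i ≤ t) ∧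
      ∀ k ≤ t, ∑ i, min (x i) k = maxTermRank k R S := by
  obtain ⟨x, ⟨hx, hxt, hxk⟩, hmin⟩ := exists_forall_le_of_exists
    (fun x : Fin m → ℕ => ∑ i : Fin m, (i : ℕ) * x i)
    (exists_isRowVector_forall_sum_min_eq (R := R) hne hS t)
  refine ⟨x, hx, fun i k hik => ?_, hxt, hxk⟩
  by_contra! hlt
  obtain ⟨y, hy, hyx⟩ := hx.exists_transfer hR hik hlt
  have hik' : i < k := lt_of_le_of_ne hik (by rintro rfl; exact lt_irrefl _ hlt)
  have h1 := hmin y ⟨hy, fun a => ?_, fun l hl => le_antisymm (hy.sum_min_le hne hS l) ?_⟩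
  · have h2 : ∑ a : Fin m, (a : ℕ) * (y a + (if a = k then 1 else 0)) =
        ∑ a : Fin m, (a : ℕ) * (x a + (if a = i then 1 else 0)) :=
      sum_congr rfl fun a _ => by rw [hyx]
    simp only [mul_add, sum_add_distrib, mul_ite, mul_one, mul_zero, sum_ite_eq', mem_univ,
      if_true] at h2
    have h3 : (i : ℕ) < k := hik'
    omega
  · have h2 := hyx a
    have := hxt a
    have := hxt k
    split_ifs at h2 <;> subst_vars <;> omega
  · rw [← hxk l hl]
    have h2 : ∀ a, min (y a) l + (if a = k then (if x k ≤ l then 1 else 0) else 0) =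
        min (x a) l + (if a = i then (if x i < l then 1 else 0) else 0) := fun a => by
      have h3 := hyx a
      split_ifs at h3 ⊢ <;> subst_vars <;> omega
    have h4 := sum_congr rfl fun a (_ : a ∈ univ) => h2 a
    simp only [sum_add_distrib, sum_ite_eq', mem_univ, if_true] at h4
    split_ifs at h4 <;> omega

theorem sum_min_succ (x : Fin m → ℕ) (k : ℕ) :
    ∑ i, min (x i) (k + 1) = ∑ i, min (x i) k + #{i | k + 1 ≤ x i} := by
  rw [card_filter, ← sum_add_distrib]
  refine sum_congr rfl fun i _ => ?_
  split_ifs <;> omega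

theorem stairMult_eq_card {x : Fin m → ℕ} {t : ℕ} (hxt : ∀ i, x i ≤ t)
    (hx : ∀ k ≤ t, ∑ i, min (x i) k = maxTermRank k R S) {k : ℕ} (hk : 1 ≤ k) (hkt : k ≤ t) :
    stairMult t R S k = #{i | x i = k} := by
  obtain ⟨l, rfl⟩ : ∃ l, k = l + 1 := ⟨k - 1, by omega⟩
  have h1 := sum_min_succ x l
  rw [hx _ hkt, hx _ (by omega)] at h1
  unfold stairMult
  split_ifs with h
  · subst h
    have h2 : #{i | l + 1 ≤ x i} = #{i | x i = l + 1} := by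
      congr 1
      ext i
      have := hxt i
      simp only [mem_filter, mem_univ, true_and]
      omega
    rw [Nat.add_sub_cancel]
    omega
  · have h2 := sum_min_succ x (l + 1)
    rw [hx _ (by omega), hx _ hkt] at h2
    have h3 : #{i | l + 1 ≤ x i} = #{i | x i = l + 1} + #{i | l + 1 + 1 ≤ x i} := by
      simp only [card_filter, ← sum_add_distrib]
      refine sum_congr rfl fun i _ => ?_
      split_ifs <;> omega
    rw [Nat.add_sub_cancel]
    omega

theorem sum_stairMult_eq_card {x : Fin m → ℕ} {t : ℕ} (hxt : ∀ i, x i ≤ t)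
    (hx : ∀ k ≤ t, ∑ i, min (x i) k = maxTermRank k R S) {k : ℕ} (hk : 1 ≤ k) :
    ∑ l ∈ Icc k t, stairMult t R S l = #{i | k ≤ x i} := by
  rw [card_eq_sum_card_fiberwise (f := x) (t := Icc k t)
    fun i hi => by simpa using ⟨by simpa using hi, hxt i⟩, Nat.cast_sum]
  refine sum_congr rfl fun l hl => ?_
  rw [mem_Icc] at hl
  rw [stairMult_eq_card hxt hx (by omega) hl.2, filter_filter]
  congr 2
  ext i
  simp only [mem_filter, mem_univ, true_and]
  omega

end Maximal

end TermRank

/-- Rows and columns are indexed from `0`, so row `i : Fin m` is the `(i + 1)`-st row. The block of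
rows that carry `k` ones starts after `p_t + ⋯ + p_{k+1}` rows and has length `p_k`. -/
theorem theorem5p2 (m n t : ℕ) (ht : 0 < t) (R : Fin m → ℕ) (S : Fin n → ℕ)
    (hR : Antitone R) (hS : Antitone S)
    (hne : (TermRank.matrixClass R S).Nonempty)
    (htn : TermRank.maxTermRank t R S ≤ n) :
    (∀ k, 1 ≤ k → k ≤ t → 0 ≤ TermRank.stairMult t R S k) ∧
    ∃ A ∈ TermRank.matrixClass R S, ∃ B : Matrix (Fin m) (Fin n) ℕ,
      TermRank.IsZeroOne B ∧ (∀ i j, B i j ≤ A i j) ∧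
      (∀ k, 1 ≤ k → k ≤ t → TermRank.termRank k A = TermRank.maxTermRank k R S) ∧
      TermRank.entrySum B = TermRank.maxTermRank t R S ∧
      (∀ i j, B i j = 1 →
        (i : ℕ) < TermRank.maxTermRank 1 R S ∧ (j : ℕ) < TermRank.maxTermRank t R S) ∧
      (∀ j : Fin n, (j : ℕ) < TermRank.maxTermRank t R S → TermRank.colSum B j = 1) ∧
      (∀ i : Fin m, (i : ℕ) < TermRank.maxTermRank 1 R S → TermRank.rowSum B i ≤ t) ∧
      (∀ k, 1 ≤ k → k ≤ t → ∀ i : Fin m,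
        ∑ l ∈ Finset.Ioc k t, TermRank.stairMult t R S l ≤ (i : ℤ) →
        (i : ℤ) < ∑ l ∈ Finset.Icc k t, TermRank.stairMult t R S l →
        TermRank.rowSum B i = k) := by
  obtain ⟨x, hx, hanti, hxt, hxk⟩ := TermRank.exists_antitone_isRowVector hne hR hS t
  refine ⟨fun k hk hkt => ?_, ?_⟩
  · rw [TermRank.stairMult_eq_card hxt hxk hk hkt]
    exact Int.natCast_nonneg _
  obtain ⟨A, hA, B, hB, hle, hr, hc⟩ := hx.exists_selection hne hS
  have hsum : ∑ i, x i = TermRank.maxTermRank t R S := by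
    rw [← hxk t le_rfl]
    exact Finset.sum_congr rfl fun i _ => (min_eq_left (hxt i)).symm
  have hrow : TermRank.rowSum B = x := funext hr
  have hlt : ∀ k (i : Fin m), k ≤ x i ↔ (i : ℕ) < Finset.card {a | k ≤ x a} := fun k i =>
    TermRank.iff_lt_card_filter (fun a => k ≤ x a) (fun _ _ hij h => h.trans (hanti hij)) i
  refine ⟨A, hA, B, hB, hle, fun k _ hkt => le_antisymm
    ((TermRank.maxTermRank_isGreatest k R S hne).2 ⟨A, hA, rfl⟩) ?_, ?_, fun i j hij => ⟨?_, ?_⟩,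
    fun j hj => ?_, fun i _ => (hr i).trans_le (hxt i), fun k hk hkt i h1 h2 => ?_⟩
  · rw [← hxk k hkt, ← hrow]
    exact TermRank.sum_min_rowSum_le_termRank hB hle
      (fun j => by rw [hc]; split_ifs <;> simp) k
  · rw [TermRank.entrySum_eq_sum_rowSum, hrow, hsum]
  · have h1 : 1 ≤ x i := by
      rw [← hr i, ← hij]
      exact Finset.single_le_sum (fun b _ => Nat.zero_le (B i b)) (Finset.mem_univ j)
    have h2 := TermRank.sum_min_succ x 0
    rw [zero_add, hxk 1 ht] at h2
    have h3 := (hlt 1 i).1 h1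
    omega
  · have h1 : 1 ≤ TermRank.colSum B j := by
      rw [← hij]
      exact Finset.single_le_sum (fun a _ => Nat.zero_le (B a j)) (Finset.mem_univ i)
    rw [hc, hsum] at h1
    by_contra h
    rw [if_neg h] at h1
    omega
  · rw [hc, hsum, if_pos hj]
  · rw [TermRank.sum_stairMult_eq_card hxt hxk hk] at h2
    rw [← Finset.Icc_add_one_left_eq_Ioc, TermRank.sum_stairMult_eq_card hxt hxk (by omega)] at h1
    have h3 := hlt k i
    have h4 := hlt (k + 1) i
    rw [hr]
    omega
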